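/- Let $k$ be an algebraically closed field of characteristic zero, let $\mathfrak g$ be a finite-dimensional simple Lie algebra over $k$ with Cartan subalgebra $\mathfrak h$ and root system $\Delta$, and let $\pi\subset\Delta$ be a set of simple roots. Write $\gamma^\vee$ for the coroot of $\gamma\in\Delta$. The height of a coroot is the sum of its coefficients with respect to the simple coroots $\alpha^\vee$, $\alpha\in\pi$; let $\Delta^{\vee+}_r$ be the set of positive coroots of height $r$, and let $n_r:=|\Delta^{\vee+}_r|$. Let $\mathfrak g^\vee$ be the Langlands dual of $\mathfrak g$, that is, the semisimple Lie algebra with a Cartan subalgebra whose root system is the dual root system $\Delta^\vee=\{\gamma^\vee:\gamma\in\Delta\}$, and let $x_{\gamma^\vee}$, $\gamma\in\Delta$, be the root vectors in a Chevalley basis of $\mathfrak g^\vee$. Define the structure constants by $[x_{\beta^\vee},x_{\gamma^\vee}]=N_{\beta^\vee,\gamma^\vee}\,x_{\beta^\vee+\gamma^\vee}$ if $\beta^\vee+\gamma^\vee$ is a coroot, and $N_{\beta^\vee,\gamma^\vee}=0$ if it is not. For every integer $r\ge 2$ let $M_r$ be the $n_r\times n_{r-1}$ matrix over $k$ with rows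 indexed by $\gamma^\vee\in\Delta^{\vee+}_r$ and columns indexed by $\delta^\vee\in\Delta^{\vee+}_{r-1}$, whose $(\gamma^\vee,\delta^\vee)$ entry is $N_{-\alpha^\vee,\gamma^\vee}$ if $\delta^\vee=\gamma^\vee-\alpha^\vee$ for some (then unique) $\alpha\in\pi$, and $0$ otherwise. Then $M_r$ has rank $n_r$. -/

import Mathlib

set_option linter.unusedSectionVars false

noncomputable section

namespace Langlands

open LieAlgebra LieAlgebra.IsKilling

section RootVectors

variable {k L : Type*} [Field k] [CharZero k] [LieRing L] [LieAlgebra k L]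
  [LieAlgebra.IsKilling k L] [FiniteDimensional k L]
  {H : LieSubalgebra k L} [H.IsCartanSubalgebra] [LieModule.IsTriangularizable k H L]

/-- The root `-α`. -/
def negRoot (α : H.root) : H.root :=
  ⟨-α.1, by
    have h := α.2
    simp only [LieSubalgebra.root, Finset.mem_filter, Finset.mem_univ, true_and] at h ⊢
    simpa using h⟩

/-- The family `x` of vectors of `L`, indexed by the roots, is the family of root vectors of a
Chevalley basis of `L` relative to the Cartan subalgebra `H`: the vector `x α` lies in the root
space of `α`, the bracket of `x α` and `x (-α)` is the coroot of `α`, and whenever `α + β` is a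
root, the scalars `c`, `c'` with `⁅x α, x β⁆ = c • x (α + β)` and
`⁅x (-α), x (-β)⁆ = c' • x (-(α + β))` satisfy `c' = -c`.
(The full Chevalley basis consists of these vectors and of the simple coroots.) -/
structure IsChevalleySystem (x : H.root → L) : Prop where
  mem_rootSpace (α : H.root) : x α ∈ rootSpace H α.1
  lie_neg (α : H.root) : ⁅x α, x (negRoot α)⁆ = (coroot α.1 : L)
  lie_add (α β γ : H.root) (h : ⇑γ.1 = ⇑α.1 + ⇑β.1) :
    ∃ c : k, ⁅x α, x β⁆ = c • x γ ∧
      ⁅x (negRoot α), x (negRoot β)⁆ = (-c) • x (negRoot γ)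

open Classical in
/-- The structure constant `N_{α, β}` of a family of root vectors: the scalar with
`⁅x α, x β⁆ = N_{α, β} • x (α + β)` if `α + β` is a root, and `0` if `α + β` is not a root. -/
def structureConst (x : H.root → L) (α β : H.root) : k :=
  if h : ∃ c : k, ∃ γ : H.root, ⇑γ.1 = ⇑α.1 + ⇑β.1 ∧ ⁅x α, x β⁆ = c • x γ then h.choose else 0

/-- The defining property of the structure constants. -/
theorem IsChevalleySystem.lie_eq {x : H.root → L} (hx : IsChevalleySystem x) (α β γ : H.root)
    (h : ⇑γ.1 = ⇑α.1 + ⇑β.1) : ⁅x α, x β⁆ = structureConst x α β • x γ := by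
  have hex : ∃ c : k, ∃ γ : H.root, ⇑γ.1 = ⇑α.1 + ⇑β.1 ∧ ⁅x α, x β⁆ = c • x γ := by
    obtain ⟨c, hc, -⟩ := hx.lie_add α β γ h
    exact ⟨c, γ, h, hc⟩
  obtain ⟨γ', h', e'⟩ := hex.choose_spec
  have hγ : γ' = γ := Subtype.ext (DFunLike.coe_injective (h'.trans h.symm))
  rw [structureConst, dif_pos hex, ← hγ]
  exact e'

/-- The convention on the structure constants when `α + β` is not a root. -/
theorem structureConst_eq_zero (x : H.root → L) (α β : H.root)
    (h : ∀ γ : H.root, ⇑γ.1 ≠ ⇑α.1 + ⇑β.1) : structureConst x α β = 0 :=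
  dif_neg fun ⟨_, γ, hγ, _⟩ => h γ hγ

end RootVectors

section Dual

variable {k : Type*} [Field k] [CharZero k]
  {𝔤 : Type*} [LieRing 𝔤] [LieAlgebra k 𝔤] [LieAlgebra.IsKilling k 𝔤] [FiniteDimensional k 𝔤]
  {𝔤' : Type*} [LieRing 𝔤'] [LieAlgebra k 𝔤'] [LieAlgebra.IsKilling k 𝔤'] [FiniteDimensional k 𝔤']
  {H : LieSubalgebra k 𝔤} [H.IsCartanSubalgebra] [LieModule.IsTriangularizable k H 𝔤]
  {H' : LieSubalgebra k 𝔤'} [H'.IsCartanSubalgebra] [LieModule.IsTriangularizable k H' 𝔤']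

/-- A Langlands duality between semisimple Lie algebras with Cartan subalgebras `(𝔤, H)` and
`(𝔤', H')`: an identification of the root system of `(𝔤', H')` with the dual of the root system of
`(𝔤, H)`. It identifies `H'` with the dual space of `H`, and the roots of `𝔤'` with the
coroots of `𝔤`. -/
abbrev Duality (H : LieSubalgebra k 𝔤) [H.IsCartanSubalgebra]
    [LieModule.IsTriangularizable k H 𝔤]
    (H' : LieSubalgebra k 𝔤') [H'.IsCartanSubalgebra] [LieModule.IsTriangularizable k H' 𝔤'] :=
  RootPairing.Equiv (rootSystem H') (rootSystem H).flip

/-- For a root `γ` of `𝔤`, the root of the Langlands dual `𝔤'` which corresponds to the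
coroot of `γ`. -/
def Duality.dualRoot (D : Duality H H') (γ : H.root) : H'.root :=
  D.indexEquiv.symm γ

/-- The positive coroots of height `r > 0`, relative to a base `b` of the root system; the coroots
are indexed by the roots. The height of a coroot is the sum of its coefficients with respect
to the simple coroots, and a coroot is positive if and only if its height is. -/
abbrev corootsOfHeight (b : (rootSystem H).Base) (r : ℤ) : Type _ :=
  {γ : H.root // b.flip.height γ = r}

open Classical in
/-- The matrix `M_r`, whose rows are indexed by the coroots `γ` of height `r` and whose columns are
indexed by the coroots `δ` of height `r - 1`. Its entry at `(γ, δ)` is the structure constant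
`N_{-α, γ}` of the Langlands dual if `δ = γ - α` for a simple coroot `α` (which is then
unique), and `0` if there is no such `α`. -/
def heightMatrix (D : Duality H H') (b : (rootSystem H).Base) (x : H'.root → 𝔤') (r : ℤ) :
    Matrix (corootsOfHeight b r) (corootsOfHeight b (r - 1)) k :=
  Matrix.of fun γ δ => ∑ α ∈ b.support,
    if (rootSystem H).coroot δ.1 = (rootSystem H).coroot γ.1 - (rootSystem H).coroot α then
      structureConst x (D.dualRoot (negRoot α)) (D.dualRoot γ.1)
    else 0

end Dual

end Langlands

end

namespace Langlands

open LieAlgebra LieAlgebra.IsKilling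

section RootVectors

variable {k L : Type*} [Field k] [CharZero k] [LieRing L] [LieAlgebra k L]
  [LieAlgebra.IsKilling k L] [FiniteDimensional k L]
  {H : LieSubalgebra k L} [H.IsCartanSubalgebra] [LieModule.IsTriangularizable k H L]

/-! Let `f` be the sum of the negative simple root vectors of the dual algebra. Row `γ` of the
matrix lists the coordinates of `⁅f, x_γ⁆` in the root vectors of height `r - 1`
(`lie_negSimpleSum_eq`), so full row rank means that `ad f` is injective on the span of the root
vectors of height `r`. The vector `f` belongs to a principal `sl₂`-triple whose `h` acts on a root
vector by twice its height (`exists_principal_triple`). In a finite-dimensional `sl₂`-module, a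
nonzero `h`-eigenvector killed by `f` has eigenvalue in `-ℕ`, which excludes `2 * r`
(`eq_zero_of_lie_negSimpleSum`). -/

lemma coe_negRoot (α : H.root) : ⇑(negRoot α).1 = -⇑α.1 := LieModule.Weight.coe_neg

namespace IsChevalleySystem

variable {x : H.root → L} (hx : IsChevalleySystem x)
include hx

lemma ne_zero (α : H.root) : x α ≠ 0 := by
  intro h
  have h₁ := hx.lie_neg α
  rw [h, zero_lie] at h₁
  exact (rootSystem H).flip.ne_zero α (Subtype.ext h₁.symm)

lemma linearIndependent : LinearIndependent k x := by
  have hind := (LieModule.iSupIndep_genWeightSpace' k H L).comp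
    (Subtype.val_injective : Function.Injective ((↑) : H.root → LieModule.Weight k H L))
  rw [← LieSubmodule.iSupIndep_toSubmodule] at hind
  exact iSupIndep.linearIndependent _ hind hx.mem_rootSpace hx.ne_zero

lemma coe_lie (h : H) (α : H.root) : ⁅(h : L), x α⁆ = α.1 h • x α :=
  lie_eq_smul_of_mem_rootSpace (hx.mem_rootSpace α) h

/-- Root vectors commute if the sum of their roots is neither zero nor a root. -/
lemma lie_eq_zero {α β : H.root} (h₀ : ⇑α.1 + ⇑β.1 ≠ 0)
    (h : ∀ γ : H.root, ⇑γ.1 ≠ ⇑α.1 + ⇑β.1) : ⁅x α, x β⁆ = 0 := by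
  have hmem : ⁅x α, x β⁆ ∈ rootSpace H (⇑α.1 + ⇑β.1) :=
    lie_mem_genWeightSpace_of_mem_genWeightSpace (hx.mem_rootSpace α) (hx.mem_rootSpace β)
  by_cases hbot : rootSpace H (⇑α.1 + ⇑β.1) = ⊥
  · rw [hbot] at hmem
    simpa using hmem
  · refine absurd rfl (h ⟨⟨⇑α.1 + ⇑β.1, hbot⟩, ?_⟩)
    exact Finset.mem_filter.mpr ⟨Finset.mem_univ _, h₀⟩

end IsChevalleySystem

end RootVectors

section Dual

variable {k : Type*} [Field k] [CharZero k]
  {𝔤 : Type*} [LieRing 𝔤] [LieAlgebra k 𝔤] [LieAlgebra.IsKilling k 𝔤] [FiniteDimensional k 𝔤]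
  {𝔤' : Type*} [LieRing 𝔤'] [LieAlgebra k 𝔤'] [LieAlgebra.IsKilling k 𝔤'] [FiniteDimensional k 𝔤']
  {H : LieSubalgebra k 𝔤} [H.IsCartanSubalgebra] [LieModule.IsTriangularizable k H 𝔤]
  {H' : LieSubalgebra k 𝔤'} [H'.IsCartanSubalgebra] [LieModule.IsTriangularizable k H' 𝔤']

namespace Duality

variable (D : Duality H H')

lemma weightMap_dualRoot (γ : H.root) :
    D.weightMap ((rootSystem H').root (D.dualRoot γ)) = (rootSystem H).coroot γ := by
  have h := RootPairing.Hom.root_weightMap_apply _ _ (D.dualRoot γ) D.toHom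
  rw [dualRoot, Equiv.apply_symm_apply] at h
  exact h

lemma weightMap_injective : Function.Injective D.weightMap :=
  D.weightEquiv.injective

lemma coweightMap_root (γ : H.root) :
    D.coweightMap ((rootSystem H).root γ) = (rootSystem H').coroot (D.dualRoot γ) :=
  RootPairing.Hom.coroot_coweightMap_apply _ _ γ D.toHom

/-- The coweight map is the transpose of the weight map. This lets a functional on `H` serve as an
element of `H'` with known eigenvalues on root vectors. -/
lemma dualRoot_coweightMap (γ : H.root) (φ : Module.Dual k H) :
    (D.dualRoot γ).1 (D.coweightMap φ) = φ ((rootSystem H).coroot γ) := by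
  have h := LinearMap.congr_fun
    (RootPairing.Hom.weight_coweight_transpose_apply _ _ φ D.toHom)
    ((rootSystem H').root (D.dualRoot γ))
  rw [LinearMap.dualMap_apply, weightMap_dualRoot] at h
  exact h.symm

lemma dualRoot_add_iff {α β γ : H.root} :
    ⇑(D.dualRoot γ).1 = ⇑(D.dualRoot α).1 + ⇑(D.dualRoot β).1 ↔
      (rootSystem H).coroot γ = (rootSystem H).coroot α + (rootSystem H).coroot β := by
  rw [← D.weightMap_dualRoot, ← D.weightMap_dualRoot, ← D.weightMap_dualRoot, ← map_add,
    D.weightMap_injective.eq_iff]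
  exact ⟨fun h ↦ LinearMap.ext fun y ↦ congrFun h y, fun h ↦ funext fun y ↦ LinearMap.congr_fun h y⟩

lemma coroot_negRoot (α : H.root) :
    (rootSystem H).coroot (negRoot α) = -(rootSystem H).coroot α :=
  coroot_neg α.1

lemma dualRoot_negRoot (α : H.root) : D.dualRoot (negRoot α) = negRoot (D.dualRoot α) := by
  apply (rootSystem H').root.injective
  apply D.weightMap_injective
  have h : (rootSystem H').root (negRoot (D.dualRoot α)) =
      -(rootSystem H').root (D.dualRoot α) := by
    ext y
    exact congrFun (coe_negRoot (D.dualRoot α)) y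
  rw [h, map_neg, weightMap_dualRoot, weightMap_dualRoot, coroot_negRoot]

lemma dualRoot_surjective : Function.Surjective D.dualRoot := D.indexEquiv.symm.surjective

lemma dualRoot_injective : Function.Injective D.dualRoot := D.indexEquiv.symm.injective

/-- Root vectors of the dual algebra commute if the sum of the coroots is neither zero nor
a coroot. -/
lemma lie_eq_zero {x : H'.root → 𝔤'} (hx : IsChevalleySystem x) {α β : H.root}
    (h₀ : (rootSystem H).coroot α + (rootSystem H).coroot β ≠ 0)
    (h : ∀ γ, (rootSystem H).coroot γ ≠ (rootSystem H).coroot α + (rootSystem H).coroot β) :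
    ⁅x (D.dualRoot α), x (D.dualRoot β)⁆ = 0 := by
  refine hx.lie_eq_zero (fun h' ↦ h₀ ?_) fun γ' ↦ ?_
  · rw [← D.weightMap_dualRoot, ← D.weightMap_dualRoot, ← map_add]
    rw [show (rootSystem H').root (D.dualRoot α) + (rootSystem H').root (D.dualRoot β) = 0 from
      LinearMap.ext fun y ↦ congrFun h' y, map_zero]
  · obtain ⟨γ, rfl⟩ := D.dualRoot_surjective γ'
    exact fun h' ↦ h γ (D.dualRoot_add_iff.mp h')

end Duality

lemma height_flip_eq_sum (b : (rootSystem H).Base) (φ : Module.Dual k H)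
    (hφ : ∀ α ∈ b.support, φ ((rootSystem H).coroot α) = 2) (γ : H.root) :
    φ ((rootSystem H).coroot γ) = 2 * (b.flip.height γ : k) := by
  obtain ⟨f, hf⟩ : ∃ f : H.root → ℤ,
      ∑ α ∈ b.support, f α • (rootSystem H).coroot α = (rootSystem H).coroot γ :=
    Submodule.mem_span_image_finset_iff_exists_fun' ℤ |>.mp (b.coroot_mem_span_int γ)
  have h : b.flip.height γ = ∑ α ∈ b.support, f α := b.flip.height_eq_sum hf.symm
  rw [h, ← hf, map_sum, Int.cast_sum, Finset.mul_sum]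
  refine Finset.sum_congr rfl fun α hα ↦ ?_
  rw [map_zsmul, hφ α hα, zsmul_eq_mul, mul_comm]

/-- Simple coroots are linearly independent, so values on them can be prescribed. The value 2 makes
the image of `φ` in `H'` the neutral element of the principal triple. -/
lemma exists_dual_coroot_eq_two (b : (rootSystem H).Base) :
    ∃ φ : Module.Dual k H, ∀ α ∈ b.support, φ ((rootSystem H).coroot α) = 2 := by
  have hli : LinearIndependent k fun α : b.support ↦ (rootSystem H).coroot α :=
    b.linearIndepOn_coroot
  let B := Module.Basis.extend hli.linearIndepOn_id
  refine ⟨B.constr k fun _ ↦ 2, fun α hα ↦ ?_⟩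
  have hmem : (rootSystem H).coroot α ∈ hli.linearIndepOn_id.extend (Set.subset_univ _) :=
    Module.Basis.subset_extend hli.linearIndepOn_id ⟨⟨α, hα⟩, rfl⟩
  have h := B.constr_basis k (fun _ ↦ (2 : k)) ⟨_, hmem⟩
  rwa [Module.Basis.extend_apply_self] at h

variable (D : Duality H H') (b : (rootSystem H).Base) {x : H'.root → 𝔤'}

/-- The sum of the negative simple root vectors of the dual algebra. -/
def negSimpleSum (x : H'.root → 𝔤') : 𝔤' := ∑ α ∈ b.support, x (D.dualRoot (negRoot α))

variable (hx : IsChevalleySystem x)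
include hx

/-- The principal `sl₂`-relations in the dual algebra. -/
lemma exists_principal_triple :
    ∃ (h : H') (e : 𝔤'), ⁅e, negSimpleSum D b x⁆ = h ∧ ⁅(h : 𝔤'), e⁆ = 2 • e ∧
      ⁅(h : 𝔤'), negSimpleSum D b x⁆ = -(2 • negSimpleSum D b x) ∧
      ∀ γ, ⁅(h : 𝔤'), x (D.dualRoot γ)⁆ = (2 * (b.flip.height γ : k)) • x (D.dualRoot γ) := by
  obtain ⟨φ, hφ⟩ := exists_dual_coroot_eq_two b
  have hact (γ) : ⁅(D.coweightMap φ : 𝔤'), x (D.dualRoot γ)⁆ =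
      (2 * (b.flip.height γ : k)) • x (D.dualRoot γ) := by
    rw [hx.coe_lie, D.dualRoot_coweightMap, height_flip_eq_sum b φ hφ]
  have hsimple {α} (hα : α ∈ b.support) : ⁅(D.coweightMap φ : 𝔤'), x (D.dualRoot α)⁆ =
      (2 : k) • x (D.dualRoot α) := by
    rw [hx.coe_lie, D.dualRoot_coweightMap, hφ α hα]
  have hneg {α} (hα : α ∈ b.support) : ⁅(D.coweightMap φ : 𝔤'), x (D.dualRoot (negRoot α))⁆ =
      (-2 : k) • x (D.dualRoot (negRoot α)) := by
    rw [hx.coe_lie, D.dualRoot_coweightMap, Duality.coroot_negRoot, map_neg, hφ α hα]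
  have hspan : φ ∈ Submodule.span k ((rootSystem H).root '' b.support) := by
    rw [b.span_root_support, RootPairing.rootSpan, RootPairing.IsRootSystem.span_root_eq_top]
    trivial
  -- The coefficients of `φ` in the simple roots are those of `h` in the simple coroots of the dual
  -- algebra, hence the weights needed in `e` to get `⁅e, f⁆ = h`.
  obtain ⟨c, hc⟩ := Submodule.mem_span_image_finset_iff_exists_fun' k |>.mp hspan
  refine ⟨D.coweightMap φ, ∑ α ∈ b.support, c α • x (D.dualRoot α), ?_, ?_, ?_, hact⟩
  · rw [negSimpleSum, sum_lie_sum, ← hc, map_sum, AddSubmonoidClass.coe_finsetSum]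
    refine Finset.sum_congr rfl fun α hα ↦ ?_
    rw [Finset.sum_eq_single_of_mem α hα]
    · rw [smul_lie, D.dualRoot_negRoot, hx.lie_neg, map_smul, D.coweightMap_root]
      rfl
    -- Off-diagonal brackets vanish: a difference of distinct simple coroots is neither zero nor a
    -- coroot.
    · intro β hβ hne
      rw [smul_lie, D.lie_eq_zero hx, smul_zero]
      · rw [Duality.coroot_negRoot, ← sub_eq_add_neg, sub_ne_zero]
        exact fun h ↦ hne ((rootSystem H).coroot.injective h).symm
      · intro γ h
        rw [Duality.coroot_negRoot, ← sub_eq_add_neg] at h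
        exact b.sub_notMem_range_coroot hα hβ ⟨γ, h⟩
  · rw [lie_sum, Finset.smul_sum]
    refine Finset.sum_congr rfl fun α hα ↦ ?_
    rw [lie_smul, hsimple hα, smul_comm (c α), two_smul, two_smul]
  · rw [negSimpleSum, lie_sum, Finset.smul_sum, ← Finset.sum_neg_distrib]
    refine Finset.sum_congr rfl fun α hα ↦ ?_
    rw [hneg hα, neg_smul, two_smul, two_smul]

/-- The sum of the negative simple root vectors acts injectively on positive heights. -/
lemma eq_zero_of_lie_negSimpleSum {r : ℕ} (hr : 0 < r) {v : 𝔤'}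
    (hv : v ∈ Submodule.span k (Set.range fun γ : corootsOfHeight b r ↦ x (D.dualRoot γ.1)))
    (h₀ : ⁅negSimpleSum D b x, v⁆ = 0) : v = 0 := by
  obtain ⟨h, e, hef, he, hf, hact⟩ := exists_principal_triple D b hx
  have hhv : ⁅(h : 𝔤'), v⁆ = (2 * r : k) • v := by
    clear h₀
    induction hv using Submodule.span_induction with
    | mem v hv =>
      obtain ⟨γ, rfl⟩ := hv
      simpa [γ.2] using hact γ.1
    | zero => simp
    | add u w _ _ hu hw => rw [lie_add, hu, hw, smul_add]
    | smul t u _ hu => rw [lie_smul, hu, smul_comm]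
  by_contra hv₀
  have hr' : (r : k) ≠ 0 := Nat.cast_ne_zero.mpr hr.ne'
  have hh : (h : 𝔤') ≠ 0 := fun hh ↦ by
    rw [hh, zero_lie] at hhv
    exact (smul_ne_zero (mul_ne_zero two_ne_zero hr') hv₀) hhv.symm
  have ht : IsSl2Triple (h : 𝔤') e (negSimpleSum D b x) := ⟨hh, hef, he, hf⟩
  -- In the opposite triple `(-h, f, e)` the vector `v` is primitive, so its weight `-2r` must be a
  -- natural number.
  have hP : ht.symm.HasPrimitiveVectorWith v (-(2 * r : k)) :=
    ⟨hv₀, by rw [neg_lie, hhv, neg_smul], h₀⟩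
  obtain ⟨n, hn⟩ := hP.exists_nat
  have : ((2 * r + n : ℕ) : k) = 0 := by push_cast; rw [← hn]; ring
  rw [Nat.cast_eq_zero] at this
  omega

/-- The rows of the height matrix describe the action of the sum of the negative simple root
vectors. -/
lemma lie_negSimpleSum_eq {r : ℤ} (hr : r ≠ 1) (γ : corootsOfHeight b r) :
    ⁅negSimpleSum D b x, x (D.dualRoot γ.1)⁆ =
      ∑ δ, heightMatrix D b x r γ δ • x (D.dualRoot δ.1) := by
  classical
  simp only [heightMatrix, Matrix.of_apply, Finset.sum_smul]
  rw [Finset.sum_comm, negSimpleSum, sum_lie]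
  refine Finset.sum_congr rfl fun α hα ↦ ?_
  have hα₁ : b.flip.height α = 1 := b.flip.height_one_of_mem_support hα
  simp only [ite_smul, zero_smul]
  by_cases h : ∃ δ, (rootSystem H).coroot δ = (rootSystem H).coroot γ.1 - (rootSystem H).coroot α
  · obtain ⟨δ, hδ⟩ := h
    have hδr : b.flip.height δ = r - 1 := by
      rw [b.flip.height_sub (i := γ.1) (j := α) hδ, γ.2, hα₁]
    rw [Finset.sum_eq_single_of_mem (⟨δ, hδr⟩ : corootsOfHeight b (r - 1)) (Finset.mem_univ _),
      if_pos hδ]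
    · refine hx.lie_eq _ _ _ (D.dualRoot_add_iff.mpr ?_)
      rw [hδ, Duality.coroot_negRoot, sub_eq_neg_add]
    · intro δ' _ hne
      rw [if_neg]
      exact fun h ↦ hne (Subtype.ext ((rootSystem H).coroot.injective (h.trans hδ.symm)))
  · rw [not_exists] at h
    rw [Finset.sum_eq_zero fun δ _ ↦ if_neg (h δ.1)]
    refine D.lie_eq_zero hx ?_ ?_
    · rw [Duality.coroot_negRoot, ← sub_eq_neg_add, sub_ne_zero]
      -- The bracket of opposite root vectors is a nonzero coroot, so `γ = α` has to be excluded;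
      -- this could only happen at height 1.
      intro h'
      have : γ.1 = α := (rootSystem H).coroot.injective h'
      exact hr (by rw [← γ.2, this, hα₁])
    · rwa [Duality.coroot_negRoot, ← sub_eq_neg_add]

lemma linearIndependent_heightMatrix_row {r : ℕ} (hr : 2 ≤ r) :
    LinearIndependent k (heightMatrix D b x r).row := by
  rw [Fintype.linearIndependent_iff]
  intro c hc
  have hli : LinearIndependent k fun γ : corootsOfHeight b r ↦ x (D.dualRoot γ.1) :=
    hx.linearIndependent.comp _ (D.dualRoot_injective.comp Subtype.val_injective)
  -- A relation among the rows gives a combination of the `x_γ` killed by `f`; it vanishes by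
  -- injectivity, hence so do its coefficients.
  refine Fintype.linearIndependent_iff.mp hli c ?_
  refine eq_zero_of_lie_negSimpleSum D b hx (by omega : 0 < r) ?_ ?_
  · exact Submodule.sum_mem _ fun γ _ ↦ Submodule.smul_mem _ _ (Submodule.subset_span ⟨γ, rfl⟩)
  · simp only [lie_sum, lie_smul, lie_negSimpleSum_eq D b hx (by omega : (r : ℤ) ≠ 1),
      Finset.smul_sum, smul_smul]
    rw [Finset.sum_comm]
    refine Finset.sum_eq_zero fun δ _ ↦ ?_
    have h := congrFun hc δ
    simp only [Finset.sum_apply, Pi.smul_apply, smul_eq_mul, Pi.zero_apply, Matrix.row] at h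
    rw [← Finset.sum_smul, h, zero_smul]

end Dual

end Langlands

theorem lemma8p2p5 {k : Type*} [Field k] [IsAlgClosed k] [CharZero k]
    {𝔤 : Type*} [LieRing 𝔤] [LieAlgebra k 𝔤] [FiniteDimensional k 𝔤] [LieAlgebra.IsSimple k 𝔤]
    (H : LieSubalgebra k 𝔤) [H.IsCartanSubalgebra]
    (b : (LieAlgebra.IsKilling.rootSystem H).Base)
    {𝔤' : Type*} [LieRing 𝔤'] [LieAlgebra k 𝔤'] [FiniteDimensional k 𝔤']
    [LieAlgebra.IsSemisimple k 𝔤']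
    (H' : LieSubalgebra k 𝔤') [H'.IsCartanSubalgebra]
    (D : Langlands.Duality H H')
    (x : H'.root → 𝔤') (hx : Langlands.IsChevalleySystem x)
    (r : ℕ) (hr : 2 ≤ r) :
    (Langlands.heightMatrix D b x r).rank = Nat.card (Langlands.corootsOfHeight b r) := by
  rw [(Langlands.linearIndependent_heightMatrix_row D b hx hr).rank_matrix,
    Nat.card_eq_fintype_card]
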